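/- All graphs are finite. A digraph $G=(V,E)$ may have multiple edges. It is semi-balanced if every cycle of its underlying undirected graph has the same number of edges oriented in the two cyclic directions (loops and pairs of parallel or antiparallel edges count as cycles). For an edge $f=\overrightarrow{th}$ put $\mathbf{x}_f=\mathbf{1}_h-\mathbf{1}_t\in\mathbb{R}^V$, and for a set $S$ of edges put $\mathcal{Q}_S=\operatorname{conv}\{\mathbf{x}_f\mid f\in S\}$. A set $\mathcal{T}$ of spanning trees of $G$ *dissects* a set $X\subset\mathbb{R}^V$ if the simplices $\mathcal{Q}_T$ $(T\in\mathcal{T})$ have pairwise disjoint relative interiors (for distinct trees) and their union is $X$. A *dissecting tree set* for a semi-balanced digraph $G$ is a set of spanning trees that dissects the root polytope $\mathcal{Q}_G=\mathcal{Q}_E$. The bidirected graph $G$ of a simple undirected graph $\mathcal{G}$ is obtained by replacing each edge $uv$ by the two directed edges $\overrightarrow{uv}$ and $\overrightarrow{vu}$; in this case a *dissecting tree set* is a set of spanning trees of $G$ (that is, of oriented spanning trees of $\mathcal{G}$) that dissects the relative boundary of the symmetric edge polytope $P_{\mathcal{G}}=\operatorname{conv}\{\mathbf{1}_u-\mathbf{1}_v,\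 \mathbf{1}_v-\mathbf{1}_u\mid uv\in E(\mathcal{G})\}$. Given a linear ordering of the edges of a digraph $G$, an edge $e$ of a spanning tree $T$ is *internally semi-passive* in $T$ if, among the edges of $G$ that connect the two components of $T-e$, the maximal one has its head in a different component of $T-e$ than the head of $e$. The *internal semi-passivity* of $T$ is the number of its internally semi-passive edges. **Statement.** Let $V$ be a finite set with $|V|\ge 2$ and let $i\in\{0,\dots,|V|-1\}$. 1. Let $G$ be the bidirected graph of a simple undirected graph with vertex set $V$. Then the value $$|\{T\in\mathcal{T}\mid T\text{ has exactly } i \text{ internally semi-passive edges}\}|$$ is the same for all dissecting tree sets $\mathcal{T}$ and all orderings of the directed edges of $G$. 2. Let $G$ be a semi-balanced digraph with vertex set $V$. Then the value $$|\{T\in\mathcal{T}\mid T\text{ has exactly } i \text{ internally semi-passive edges}\}|$$ is the same for all dissecting tree sets $\mathcal{T}$ and all orderings of the edges of $G$. -/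

import Mathlib

/-- A directed graph with vertex set `V` and edge set `E`; the edge `e` points from `tail e` to
`head e`. Loops and multiple edges are not excluded by the definition. -/
structure MultiDigraph (V E : Type*) where
  tail : E → V
  head : E → V

namespace MultiDigraph

variable {V E : Type*}

/-- A cycle of the underlying undirected graph, together with a way of going around it: distinct
vertices `vert 0, …, vert k` and distinct edges `edge 0, …, edge k` such that `edge i` joins `vert i`
and `vert (i + 1)` (indices are cyclic). `fwd i` says whether `edge i` is traversed from its tail to
its head. A loop is a cycle of length one, and two parallel or antiparallel edges form a cycle of
length two. -/
structure Cycle (G : MultiDigraph V E) where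
  k : ℕ
  vert : Fin (k + 1) → V
  edge : Fin (k + 1) → E
  fwd : Fin (k + 1) → Bool
  vert_injective : Function.Injective vert
  edge_injective : Function.Injective edge
  joins : ∀ i, if fwd i = true
    then G.tail (edge i) = vert i ∧ G.head (edge i) = vert (i + 1)
    else G.head (edge i) = vert i ∧ G.tail (edge i) = vert (i + 1)

/-- Every cycle has the same number of edges oriented in the two cyclic directions. -/
def SemiBalanced (G : MultiDigraph V E) : Prop :=
  ∀ C : G.Cycle, {i | C.fwd i = true}.ncard = {i | C.fwd i = false}.ncard

/-- `u` and `v` lie in the same connected component of the spanning subgraph with edge set `S`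
(orientations are disregarded). -/
def SameComponent (G : MultiDigraph V E) (S : Set E) (u v : V) : Prop :=
  Relation.EqvGen (fun a b => ∃ e ∈ S, G.tail e = a ∧ G.head e = b) u v

/-- The edge set `T` forms a spanning tree (in the undirected sense): it connects all vertices, and
it contains no cycle. -/
def IsSpanningTree (G : MultiDigraph V E) (T : Set E) : Prop :=
  (∀ u v, G.SameComponent T u v) ∧ ∀ C : G.Cycle, ∃ i, C.edge i ∉ T

/-- The fundamental cut `C^*(T, e)`: the edges of `G` that connect different components of `T - e`.
-/
def fundamentalCut (G : MultiDigraph V E) (T : Set E) (e : E) : Set E :=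
  {f | ¬ G.SameComponent (T \ {e}) (G.tail f) (G.head f)}

/-- The heads of `f` and `e` are in the same component of `T - e`. -/
def StandsParallel (G : MultiDigraph V E) (T : Set E) (e f : E) : Prop :=
  G.SameComponent (T \ {e}) (G.head f) (G.head e)

/-- The maximal edge of the fundamental cut `C^*(T, e)`, with respect to the ordering `o` of the
edges, stands opposite to the edge `e` of `T`. -/
def InternallySemiPassive (G : MultiDigraph V E) (o : LinearOrder E) (T : Set E) (e : E) : Prop :=
  e ∈ T ∧ ∃ f ∈ G.fundamentalCut T e,
    (∀ g ∈ G.fundamentalCut T e, o.le g f) ∧ ¬ G.StandsParallel T e f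

/-- The number of internally semi-passive edges of `T` with respect to the ordering `o`. -/
noncomputable def internalSemiPassivity (G : MultiDigraph V E) (o : LinearOrder E) (T : Set E) :
    ℕ :=
  {e | G.InternallySemiPassive o T e}.ncard

/-- The vector `1_h - 1_t` of an edge with head `h` and tail `t`. -/
def edgeVector [DecidableEq V] (G : MultiDigraph V E) (e : E) : V → ℝ :=
  Pi.single (G.head e) 1 - Pi.single (G.tail e) 1

/-- `Q_S`, the convex hull of the vectors of the edges in `S`. -/
def rootPolytopeOf [DecidableEq V] (G : MultiDigraph V E) (S : Set E) : Set (V → ℝ) :=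
  convexHull ℝ (G.edgeVector '' S)

/-- The root polytope `Q_G`. -/
def rootPolytope [DecidableEq V] (G : MultiDigraph V E) : Set (V → ℝ) :=
  G.rootPolytopeOf Set.univ

/-- `𝒯` is a set of spanning trees of `G` such that the simplices `Q_T`, `T ∈ 𝒯`, dissect the set
`X`: they have pairwise disjoint relative interiors, and their union is `X`. -/
def Dissects [DecidableEq V] (G : MultiDigraph V E) (𝒯 : Set (Set E)) (X : Set (V → ℝ)) : Prop :=
  (∀ T ∈ 𝒯, G.IsSpanningTree T) ∧
  (∀ T ∈ 𝒯, ∀ T' ∈ 𝒯, T ≠ T' →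
    Disjoint (intrinsicInterior ℝ (G.rootPolytopeOf T))
      (intrinsicInterior ℝ (G.rootPolytopeOf T'))) ∧
  (⋃ T ∈ 𝒯, G.rootPolytopeOf T) = X

/-- A dissecting tree set for the digraph `G`. -/
def IsDissectingTreeSet [DecidableEq V] (G : MultiDigraph V E) (𝒯 : Set (Set E)) : Prop :=
  G.Dissects 𝒯 G.rootPolytope

end MultiDigraph

namespace SimpleGraph

variable {V : Type*}

/-- The bidirected graph of an undirected graph: every edge `uv` is replaced by the two directed
edges from `u` to `v` and from `v` to `u`. -/
def bidirected (𝒢 : SimpleGraph V) : MultiDigraph V 𝒢.Dart where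
  tail d := d.fst
  head d := d.snd

/-- The symmetric edge polytope of an undirected graph. -/
def symmetricEdgePolytope [DecidableEq V] (𝒢 : SimpleGraph V) : Set (V → ℝ) :=
  convexHull ℝ {x | ∃ u v, 𝒢.Adj u v ∧
    (x = Pi.single u 1 - Pi.single v 1 ∨ x = Pi.single v 1 - Pi.single u 1)}

/-- A dissecting tree set for the undirected graph `𝒢`: a set of oriented spanning trees (that is, of
spanning trees of the bidirected graph) whose simplices dissect the (relative) boundary of the
symmetric edge polytope. -/
def IsDissectingTreeSet [DecidableEq V] (𝒢 : SimpleGraph V) (𝒯 : Set (Set 𝒢.Dart)) : Prop :=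
  𝒢.bidirected.Dissects 𝒯 (intrinsicFrontier ℝ 𝒢.symmetricEdgePolytope)

end SimpleGraph

/-! The passivity counts form an h*-vector: they can be recovered from the numbers of lattice points
in the dilates `kX` of the dissected set `X`, which involve neither the trees nor the ordering.

For a spanning tree `T`, the coefficient of `e` in the expansion of `x_f` over `T` is 0 off the
fundamental cut and ±1 on it, with sign + exactly when `f` stands parallel to `e`. Give the edges
positive weights, each exceeding the sum of all smaller ones, and let `q` be the weighted sum of all
`x_f`. The maximal edge of the cut decides the sign of the coefficient of `q` at `e`, so it is
negative exactly when `e` is semi-passive (`exists_generic_weight`).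

Remove from the cone over `Q_T` the facets opposite to the semi-passive edges. A point of the span
is in this half-open cone iff moving it slightly towards `q` leads into the open cone. Hence the
half-open cones of a dissecting tree set partition the cone over `X` (`exists_mem_halfOpenCone`,
`eq_of_mem_halfOpenCone`). Tree expansions are integral, so with `d = |V| - 1` a tree of passivity
`p` contributes to `kX` one lattice point for each way to write `k - p` as an ordered sum of `d`
naturals. In generating functions, the total is `∑_T t^p(T) / (1 - t)^d`, and the system is
triangular.

Two properties of `X` are used: each ray meets it at most once, and its cone contains all
nonnegative combinations of edge vectors. In the semi-balanced case `Q_G` lies in a hyperplane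
missing the origin; in the bidirected case `X` is the boundary of a polytope with the origin in its
relative interior. -/

namespace MultiDigraph

/-! ### Spanning trees, cycles and fundamental cuts. -/

section Graph

variable {V E : Type*} {G : MultiDigraph V E} {S T : Set E} {e f : E} {u v w : V}

theorem SameComponent.refl (G : MultiDigraph V E) (S : Set E) (u : V) : G.SameComponent S u u :=
  Relation.EqvGen.refl u

theorem SameComponent.symm (h : G.SameComponent S u v) : G.SameComponent S v u :=
  Relation.EqvGen.symm _ _ h

theorem SameComponent.trans (h : G.SameComponent S u v) (h' : G.SameComponent S v w) :
    G.SameComponent S u w :=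
  Relation.EqvGen.trans _ _ _ h h'

theorem SameComponent.of_mem (h : e ∈ S) : G.SameComponent S (G.tail e) (G.head e) :=
  Relation.EqvGen.rel _ _ ⟨e, h, rfl, rfl⟩

theorem SameComponent.reachable (h : G.SameComponent S u v) :
    (SimpleGraph.fromRel fun a b => ∃ e ∈ S, G.tail e = a ∧ G.head e = b).Reachable u v := by
  induction h with
  | rel a b hab =>
    by_cases h : a = b
    · exact h ▸ SimpleGraph.Reachable.refl _
    · exact SimpleGraph.Adj.reachable (by simpa [SimpleGraph.fromRel_adj, h] using Or.inl hab)
  | refl => exact SimpleGraph.Reachable.refl _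
  | symm _ _ _ ih => exact ih.symm
  | trans _ _ _ _ _ ih ih' => exact ih.trans ih'

/-- An edge outside `S` whose ends are connected by `S` closes a cycle. -/
theorem exists_cycle_of_sameComponent (hf : f ∉ S)
    (h : G.SameComponent S (G.head f) (G.tail f)) :
    ∃ (C : G.Cycle) (i : _), C.edge i = f ∧ ∀ j ≠ i, C.edge j ∈ S := by
  classical
  obtain ⟨p, hp⟩ := h.reachable.exists_isPath
  have hinj : ∀ i j : ℕ, i ≤ p.length → j ≤ p.length → p.getVert i = p.getVert j → i = j :=
    fun i j hi hj hij => hp.getVert_injOn hi hj hij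
  have hedge : ∀ j : Fin p.length, ∃ e ∈ S, ∃ b : Bool, if b = true
      then G.tail e = p.getVert j ∧ G.head e = p.getVert (j + 1)
      else G.head e = p.getVert j ∧ G.tail e = p.getVert (j + 1) := by
    intro j
    have := p.adj_getVert_succ j.2
    rw [SimpleGraph.fromRel_adj] at this
    obtain ⟨-, ⟨e, he, h1, h2⟩ | ⟨e, he, h1, h2⟩⟩ := this
    · exact ⟨e, he, true, by simp [h1, h2]⟩
    · exact ⟨e, he, false, by simp [h1, h2]⟩
  choose ed hedS b hb using hedge
  -- Equal edges at positions `i` and `j` give `i = j` if traversed alike, and otherwise both `i = j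
  -- + 1` and `i + 1 = j`.
  have hed : Function.Injective ed := by
    intro i j hij
    have h1 := hb i
    have h2 := hb j
    rw [hij] at h1
    have hi := i.2
    have hj := j.2
    by_contra hne
    have hne' : (i : ℕ) ≠ j := fun h => hne (Fin.ext h)
    split_ifs at h1 h2
    · exact hne' (hinj _ _ hi.le hj.le (h1.1.symm.trans h2.1))
    · have a1 := hinj _ _ hi.le (by lia) (h1.1.symm.trans h2.2)
      have a2 := hinj _ _ (by lia) hj.le (h1.2.symm.trans h2.1)
      lia
    · have a1 := hinj _ _ hi.le (by lia) (h1.1.symm.trans h2.2)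
      have a2 := hinj _ _ (by lia) hj.le (h1.2.symm.trans h2.1)
      lia
    · exact hne' (hinj _ _ hi.le hj.le (h1.1.symm.trans h2.1))
  -- The path runs from the head of `f` to its tail, so `f` closes it in the forward direction.
  refine ⟨⟨p.length, fun j => p.getVert j, Fin.snoc (α := fun _ => E) ed f,
    Fin.snoc (α := fun _ => Bool) b true, ?_, ?_, ?_⟩, Fin.last _, ?_, ?_⟩
  · intro i j hij
    exact Fin.ext (hinj _ _ (by lia) (by lia) hij)
  · rw [Fin.snoc_injective_iff]
    refine ⟨hed, ?_⟩
    rintro ⟨j, hj⟩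
    exact hf (hj ▸ hedS j)
  · intro i
    rcases Fin.eq_castSucc_or_eq_last i with ⟨j, rfl⟩ | rfl
    · simpa using hb j
    · simp
  · simp
  · intro j hj
    rcases Fin.eq_castSucc_or_eq_last j with ⟨j, rfl⟩ | rfl
    · simpa using hedS j
    · exact absurd rfl hj

theorem IsSpanningTree.not_sameComponent (hT : G.IsSpanningTree T) (he : e ∈ T) :
    ¬ G.SameComponent (T \ {e}) (G.tail e) (G.head e) := by
  intro h
  obtain ⟨C, i, hi, hC⟩ := exists_cycle_of_sameComponent (S := T \ {e}) (by simp) h.symm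
  obtain ⟨j, hj⟩ := hT.2 C
  by_cases hji : j = i
  · exact hj (hji ▸ hi ▸ he)
  · exact hj (hC j hji).1

theorem IsSpanningTree.mem_fundamentalCut (hT : G.IsSpanningTree T) (he : e ∈ T) :
    e ∈ G.fundamentalCut T e :=
  hT.not_sameComponent he

/-- Deleting an edge of a spanning tree leaves at most two components. -/
theorem IsSpanningTree.sameComponent_or (hT : G.IsSpanningTree T) (e : E) (v : V) :
    G.SameComponent (T \ {e}) v (G.head e) ∨ G.SameComponent (T \ {e}) v (G.tail e) := by
  have key : ∀ a b, G.SameComponent T a b →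
      ((G.SameComponent (T \ {e}) a (G.head e) ∨ G.SameComponent (T \ {e}) a (G.tail e)) ↔
      (G.SameComponent (T \ {e}) b (G.head e) ∨ G.SameComponent (T \ {e}) b (G.tail e))) := by
    intro a b h
    induction h with
    | rel a b hab =>
      obtain ⟨f, hf, rfl, rfl⟩ := hab
      by_cases hfe : f = e
      · subst hfe
        simp [SameComponent.refl]
      · have h : G.SameComponent (T \ {e}) (G.tail f) (G.head f) := .of_mem ⟨hf, hfe⟩
        exact ⟨Or.imp h.symm.trans h.symm.trans, Or.imp h.trans h.trans⟩
    | refl => rfl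
    | symm _ _ _ ih => exact ih.symm
    | trans _ _ _ _ _ ih ih' => exact ih.trans ih'
  exact (key (G.head e) v (hT.1 _ _)).1 (Or.inl (.refl _ _ _))

theorem SameComponent.single_sub_mem_span [DecidableEq V] (h : G.SameComponent T u v) :
    (Pi.single u 1 - Pi.single v 1 : V → ℝ) ∈
      Submodule.span ℝ (Set.range fun e : T => G.edgeVector e) := by
  induction h with
  | rel a b hab =>
    obtain ⟨e, he, rfl, rfl⟩ := hab
    rw [← neg_sub]
    exact neg_mem (Submodule.subset_span ⟨⟨e, he⟩, rfl⟩)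
  | refl => simp
  | symm _ _ _ ih => rw [← neg_sub]; exact neg_mem ih
  | trans a b c _ _ ih ih' => simpa using add_mem ih ih'

theorem IsSpanningTree.nonempty [Nontrivial V] (hT : G.IsSpanningTree T) : T.Nonempty := by
  by_contra h
  rw [Set.not_nonempty_iff_eq_empty] at h
  subst h
  obtain ⟨u, v, huv⟩ := exists_pair_ne V
  have key : ∀ a b, G.SameComponent ∅ a b → a = b := by
    intro a b h
    induction h with
    | rel _ _ h => simp at h
    | refl => rfl
    | symm _ _ _ ih => exact ih.symm
    | trans _ _ _ _ _ ih ih' => exact ih.trans ih'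
  exact huv (key _ _ (hT.1 u v))

end Graph

/-! ### Expansion of vectors over a spanning tree. -/

section Coordinates

variable {V E : Type*} [Fintype V] {G : MultiDigraph V E} {T : Set E} {e f : E}

/-- The coefficient of the edge `e` of the spanning tree `T` in the expansion of a vector with
coordinate sum zero: the sum of the coordinates on the component of `T - e` that contains the head
of `e`. -/
noncomputable def treeCoord (G : MultiDigraph V E) (T : Set E) (e : E) : (V → ℝ) →ₗ[ℝ] ℝ :=
  ∑ v, {v | G.SameComponent (T \ {e}) v (G.head e)}.indicator (1 : V → ℝ) v • LinearMap.proj v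

theorem treeCoord_apply (G : MultiDigraph V E) (T : Set E) (e : E) (y : V → ℝ) :
    G.treeCoord T e y =
      ∑ v, {v | G.SameComponent (T \ {e}) v (G.head e)}.indicator (1 : V → ℝ) v * y v := by
  simp [treeCoord, LinearMap.sum_apply]

/-- Unimodularity of the tree simplices: a coefficient is a sum of coordinates of the vector. -/
theorem exists_int_treeCoord_eq (G : MultiDigraph V E) (T : Set E) (e : E) {y : V → ℝ}
    (hy : ∀ v, ∃ n : ℤ, y v = n) : ∃ n : ℤ, G.treeCoord T e y = n := by
  classical
  choose n hn using hy
  refine ⟨∑ v, {v | G.SameComponent (T \ {e}) v (G.head e)}.indicator (1 : V → ℤ) v * n v, ?_⟩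
  rw [treeCoord_apply]
  push_cast
  refine Finset.sum_congr rfl fun v _ => ?_
  rw [hn]
  congr 1
  simp only [Set.indicator_apply]
  split_ifs <;> simp

variable [DecidableEq V]

theorem treeCoord_edgeVector (G : MultiDigraph V E) (T : Set E) (e f : E) :
    G.treeCoord T e (G.edgeVector f) =
      {v | G.SameComponent (T \ {e}) v (G.head e)}.indicator (1 : V → ℝ) (G.head f) -
      {v | G.SameComponent (T \ {e}) v (G.head e)}.indicator (1 : V → ℝ) (G.tail f) := by
  simp [treeCoord_apply, edgeVector, mul_sub, Finset.sum_sub_distrib, Pi.single_apply]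

theorem abs_treeCoord_edgeVector_le (G : MultiDigraph V E) (T : Set E) (e f : E) :
    |G.treeCoord T e (G.edgeVector f)| ≤ 1 := by
  classical
  rw [treeCoord_edgeVector]
  simp only [Set.indicator_apply]
  split_ifs <;> simp

theorem treeCoord_edgeVector_of_notMem_cut (h : f ∉ G.fundamentalCut T e) :
    G.treeCoord T e (G.edgeVector f) = 0 := by
  classical
  have h : G.SameComponent (T \ {e}) (G.tail f) (G.head f) := not_not.1 h
  have : G.SameComponent (T \ {e}) (G.tail f) (G.head e) ↔
      G.SameComponent (T \ {e}) (G.head f) (G.head e) := ⟨h.symm.trans, h.trans⟩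
  rw [treeCoord_edgeVector]
  simp [Set.indicator_apply, this]

theorem treeCoord_edgeVector_of_standsParallel (hf : f ∈ G.fundamentalCut T e)
    (h : G.StandsParallel T e f) : G.treeCoord T e (G.edgeVector f) = 1 := by
  classical
  have h' : ¬ G.SameComponent (T \ {e}) (G.tail f) (G.head e) := fun h' => hf (h'.trans h.symm)
  have h : G.SameComponent (T \ {e}) (G.head f) (G.head e) := h
  rw [treeCoord_edgeVector]
  simp [h, h']

theorem IsSpanningTree.treeCoord_edgeVector_of_not_standsParallel (hT : G.IsSpanningTree T)
    (hf : f ∈ G.fundamentalCut T e) (h : ¬ G.StandsParallel T e f) :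
    G.treeCoord T e (G.edgeVector f) = -1 := by
  classical
  have h : ¬ G.SameComponent (T \ {e}) (G.head f) (G.head e) := h
  have h' : G.SameComponent (T \ {e}) (G.tail f) (G.head e) :=
    (hT.sameComponent_or e (G.tail f)).resolve_right fun h2 =>
      hf (h2.trans ((hT.sameComponent_or e (G.head f)).resolve_left h).symm)
  rw [treeCoord_edgeVector]
  simp [h, h']

theorem IsSpanningTree.treeCoord_self (hT : G.IsSpanningTree T) (he : e ∈ T) :
    G.treeCoord T e (G.edgeVector e) = 1 :=
  treeCoord_edgeVector_of_standsParallel (hT.mem_fundamentalCut he) (.refl _ _ _)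

theorem treeCoord_of_ne (hf : f ∈ T) (hfe : f ≠ e) :
    G.treeCoord T e (G.edgeVector f) = 0 :=
  treeCoord_edgeVector_of_notMem_cut (not_not.2 (.of_mem ⟨hf, hfe⟩))

theorem sum_edgeVector (G : MultiDigraph V E) (f : E) : ∑ v, G.edgeVector f v = 0 := by
  simp [edgeVector, Finset.sum_sub_distrib]

theorem sum_linearCombination {ι : Type*} [Fintype ι] (a : ι → ℝ) (b : ι → E) :
    ∑ v, (∑ i, a i • G.edgeVector (b i)) v = 0 := by
  simp only [Finset.sum_apply, Pi.smul_apply, smul_eq_mul]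
  rw [Finset.sum_comm]
  simp [← Finset.mul_sum, sum_edgeVector]

theorem IsSpanningTree.mem_span (hT : G.IsSpanningTree T) {y : V → ℝ} (hy : ∑ v, y v = 0) :
    y ∈ Submodule.span ℝ (Set.range fun e : T => G.edgeVector e) := by
  rcases isEmpty_or_nonempty V with hV | ⟨⟨u⟩⟩
  · rw [Subsingleton.elim y 0]; exact zero_mem _
  have : y = ∑ v, y v • (Pi.single v 1 - Pi.single u 1 : V → ℝ) := by
    simp only [smul_sub, Finset.sum_sub_distrib, ← Finset.sum_smul, hy, zero_smul, sub_zero]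
    ext w
    simp [Finset.sum_apply, Pi.single_apply]
  rw [this]
  exact sum_mem fun v _ => Submodule.smul_mem _ _ (hT.1 v u).single_sub_mem_span

variable [Fintype T]

theorem IsSpanningTree.treeCoord_sum (hT : G.IsSpanningTree T) (a : T → ℝ) (e : T) :
    G.treeCoord T e (∑ f : T, a f • G.edgeVector f) = a e := by
  rw [map_sum, Finset.sum_eq_single e]
  · simp [hT.treeCoord_self e.2]
  · intro f _ hf
    simp [treeCoord_of_ne f.2 (fun h => hf (Subtype.ext h))]
  · simp

theorem IsSpanningTree.sum_treeCoord_smul (hT : G.IsSpanningTree T) {y : V → ℝ}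
    (hy : ∑ v, y v = 0) : ∑ e : T, G.treeCoord T e y • G.edgeVector e = y := by
  obtain ⟨a, rfl⟩ := (Submodule.mem_span_range_iff_exists_fun ℝ).1 (hT.mem_span hy)
  simp only [hT.treeCoord_sum]

/-- The edge vectors of `T` are a basis of the space of vectors with coordinate sum zero. Thus all
trees have the same number of edges and their counting functions differ only through passivity. -/
theorem IsSpanningTree.card_eq (hT : G.IsSpanningTree T) :
    Fintype.card T =
      Module.finrank ℝ (LinearMap.ker (∑ v, LinearMap.proj v : (V → ℝ) →ₗ[ℝ] ℝ)) := by
  have hli : LinearIndependent ℝ fun e : T => G.edgeVector e := by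
    rw [Fintype.linearIndependent_iff]
    intro a ha e
    rw [← hT.treeCoord_sum a e, ha, map_zero]
  rw [← finrank_span_eq_card hli]
  have : Submodule.span ℝ (Set.range fun e : T => G.edgeVector e) =
      LinearMap.ker (∑ v, LinearMap.proj v : (V → ℝ) →ₗ[ℝ] ℝ) := by
    apply le_antisymm
    · rw [Submodule.span_le]
      rintro _ ⟨e, rfl⟩
      simpa [LinearMap.sum_apply] using sum_edgeVector G e
    · intro y hy
      exact hT.mem_span (by simpa [LinearMap.sum_apply] using hy)
  rw [this]

end Coordinates

/-! ### Convex hulls and relative interiors. -/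

section Convex

theorem mem_convexHull_image_iff {E W : Type*} [AddCommGroup W] [Module ℝ W] (x : E → W)
    (S : Set E) [Fintype S] {y : W} :
    y ∈ convexHull ℝ (x '' S) ↔
      ∃ a : S → ℝ, (∀ e, 0 ≤ a e) ∧ ∑ e, a e = 1 ∧ ∑ e, a e • x e = y := by
  classical
  constructor
  · intro hy
    have h1 : x '' S = Fintype.linearCombination ℝ (fun e : S => x e) ''
        Set.range fun e : S => Pi.single e (1 : ℝ) := by
      rw [← Set.range_comp, Set.image_eq_range]
      congr 1
      ext e
      simp
    rw [h1, ← LinearMap.image_convexHull, convexHull_rangle_single_eq_stdSimplex] at hy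
    obtain ⟨a, ⟨ha, ha'⟩, rfl⟩ := hy
    exact ⟨a, ha, ha', by simp [Fintype.linearCombination_apply]⟩
  · rintro ⟨a, h0, h1, h2⟩
    exact mem_convexHull_of_exists_fintype a (fun e : S => x e) h0 h1
      (fun e => Set.mem_image_of_mem x e.2) h2

theorem mem_intrinsicInterior_of_isOpen {W : Type*} [AddCommGroup W] [Module ℝ W]
    [TopologicalSpace W] [IsTopologicalAddGroup W] {s U : Set W} (hU : IsOpen U) {y : W}
    (hys : y ∈ s) (hyU : y ∈ U)
    (h : ∀ z ∈ affineSpan ℝ s, z ∈ U → z ∈ s) : y ∈ intrinsicInterior ℝ s := by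
  rw [mem_intrinsicInterior]
  refine ⟨⟨y, subset_affineSpan ℝ s hys⟩, ?_, rfl⟩
  rw [mem_interior]
  exact ⟨Subtype.val ⁻¹' U, fun z hz => h z z.2 hz, hU.preimage continuous_subtype_val, hyU⟩

theorem apply_eq_of_mem_affineSpan {W : Type*} [AddCommGroup W] [Module ℝ W]
    (φ : W →ₗ[ℝ] ℝ) {s : Set W} {r : ℝ} (h : ∀ z ∈ s, φ z = r) {z : W}
    (hz : z ∈ affineSpan ℝ s) : φ z = r := by
  have : affineSpan ℝ s ≤ (affineSpan ℝ {r}).comap φ.toAffineMap := by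
    rw [affineSpan_le]
    intro z hz
    simp [h z hz]
  simpa using this hz

end Convex

/-- Powers of two, with the rank in the ordering as exponent: each exceeds the sum of all the
smaller ones. -/
theorem exists_dominating_weight (E : Type*) [Fintype E] (o : LinearOrder E) :
    ∃ w : E → ℝ, (∀ f, 0 < w f) ∧ ∀ s : E → ℝ, (∀ g, |s g| ≤ 1) → ∀ f, s f = 1 →
      (∀ g, o.lt f g → s g = 0) → 0 < ∑ g, w g * s g := by
  classical
  let r : E → ℕ := fun f => (Finset.univ.filter fun g => o.lt g f).card
  have hr : ∀ f g, o.lt f g → r f < r g := by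
    intro f g hfg
    apply Finset.card_lt_card
    rw [Finset.ssubset_iff]
    refine ⟨f, by simp, ?_⟩
    intro a
    simp only [Finset.mem_insert, Finset.mem_filter, Finset.mem_univ, true_and]
    rintro (rfl | h)
    · exact hfg
    · exact lt_trans h hfg
  have hinj : Function.Injective r := by
    intro f g hfg
    rcases lt_trichotomy f g with h | h | h
    · exact absurd hfg (hr _ _ h).ne
    · exact h
    · exact absurd hfg (hr _ _ h).ne'
  refine ⟨fun f => 2 ^ r f, fun f => by positivity, fun s hs f hf hlt => ?_⟩
  have h1 : ∑ g ∈ Finset.univ.filter (fun g => o.lt g f), (2 : ℝ) ^ r g < 2 ^ r f := by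
    have : ∑ g ∈ Finset.univ.filter (fun g => o.lt g f), 2 ^ r g < 2 ^ r f := by
      rw [← Finset.sum_image (f := fun k : ℕ => 2 ^ k) (g := r) hinj.injOn]
      apply Nat.geomSum_lt le_rfl
      simp only [Finset.mem_image, Finset.mem_filter, Finset.mem_univ, true_and]
      rintro _ ⟨g, hg, rfl⟩
      exact hr _ _ hg
    exact_mod_cast this
  have h2 : ∀ g, (if g = f then (2 : ℝ) ^ r f else 0) - (if o.lt g f then 2 ^ r g else 0) ≤
      2 ^ r g * s g := by
    intro g
    have hp : (0 : ℝ) < 2 ^ r g := by positivity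
    rcases lt_trichotomy g f with h | h | h
    · have := (abs_le.1 (hs g)).1
      simp only [h.ne, h, if_true, if_false]
      nlinarith
    · subst h
      simp [hf]
    · simp [h.ne', hlt g h, not_lt_of_gt h]
  have h3 := Finset.sum_le_sum fun g (_ : g ∈ Finset.univ) => h2 g
  rw [Finset.sum_sub_distrib, Finset.sum_ite_eq' Finset.univ f, ← Finset.sum_filter] at h3
  simp only [Finset.mem_univ, if_true] at h3
  linarith

/-! ### The simplex of a spanning tree and the cone over it. -/

section Polytope

variable {V E : Type*} [Fintype V] [DecidableEq V] {G : MultiDigraph V E} {T : Set E} [Fintype T]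

theorem IsSpanningTree.exists_eq_smul (hT : G.IsSpanningTree T) (hne : T.Nonempty) {y : V → ℝ}
    (hy : ∑ v, y v = 0) (h : ∀ e : T, 0 ≤ G.treeCoord T e y) :
    ∃ x ∈ G.rootPolytopeOf T, y = (∑ e : T, G.treeCoord T e y) • x := by
  rcases eq_or_lt_of_le (Finset.sum_nonneg fun e (_ : e ∈ Finset.univ) => h e) with h0 | h0
  · obtain ⟨e, he⟩ := hne
    refine ⟨G.edgeVector e, subset_convexHull _ _ ⟨e, he, rfl⟩, ?_⟩
    rw [← h0, zero_smul, ← hT.sum_treeCoord_smul hy]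
    refine Finset.sum_eq_zero fun e _ => ?_
    rw [(Finset.sum_eq_zero_iff_of_nonneg fun e _ => h e).1 h0.symm e (Finset.mem_univ _), zero_smul]
  · refine ⟨(∑ e : T, G.treeCoord T e y)⁻¹ • y, ?_, (smul_inv_smul₀ h0.ne' y).symm⟩
    refine (mem_convexHull_image_iff _ _).2
      ⟨fun e => (∑ e : T, G.treeCoord T e y)⁻¹ * G.treeCoord T e y, fun e => ?_, ?_, ?_⟩
    · exact mul_nonneg (inv_nonneg.2 h0.le) (h e)
    · rw [← Finset.mul_sum, inv_mul_cancel₀ h0.ne']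
    · simp only [mul_smul, ← Finset.smul_sum, hT.sum_treeCoord_smul hy]

theorem IsSpanningTree.mem_intrinsicInterior (hT : G.IsSpanningTree T) (hne : T.Nonempty)
    {y : V → ℝ} (hy : ∑ v, y v = 0) (h : ∀ e : T, 0 < G.treeCoord T e y)
    (h1 : ∑ e : T, G.treeCoord T e y = 1) :
    y ∈ intrinsicInterior ℝ (G.rootPolytopeOf T) := by
  have key : ∀ z : V → ℝ, ∑ v, z v = 0 → (∀ e : T, 0 < G.treeCoord T e z) →
      ∑ e : T, G.treeCoord T e z = 1 → z ∈ G.rootPolytopeOf T := by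
    intro z hz h h1
    obtain ⟨x, hx, hzx⟩ := hT.exists_eq_smul hne hz fun e => (h e).le
    rw [h1, one_smul] at hzx
    exact hzx ▸ hx
  refine mem_intrinsicInterior_of_isOpen (U := ⋂ e : T, {z | 0 < G.treeCoord T e z})
    (isOpen_iInter_of_finite fun e => isOpen_lt continuous_const
      (LinearMap.continuous_of_finiteDimensional _)) (key y hy h h1) (Set.mem_iInter.2 h) ?_
  intro z hz hzU
  rw [rootPolytopeOf, affineSpan_convexHull] at hz
  refine key z ?_ (Set.mem_iInter.1 hzU) ?_
  · have := apply_eq_of_mem_affineSpan (∑ v, LinearMap.proj v : (V → ℝ) →ₗ[ℝ] ℝ) (r := 0) ?_ hz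
    · simpa [LinearMap.sum_apply] using this
    · rintro _ ⟨e, -, rfl⟩
      simpa [LinearMap.sum_apply] using sum_edgeVector G e
  · have := apply_eq_of_mem_affineSpan (∑ e : T, G.treeCoord T e) (r := 1) ?_ hz
    · simpa [LinearMap.sum_apply] using this
    · rintro _ ⟨e, he, rfl⟩
      rw [LinearMap.sum_apply, Finset.sum_eq_single ⟨e, he⟩]
      · exact hT.treeCoord_self he
      · intro f _ hf
        exact treeCoord_of_ne he fun h => hf (Subtype.ext h.symm)
      · simp

end Polytope

/-! ### The generic direction determined by an ordering. -/

section Generic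

variable {V E : Type*} [Fintype V] [DecidableEq V] {G : MultiDigraph V E} {T : Set E} {e : E}

/-- There is a positive combination of all the edge vectors that has a negative coefficient at an
edge of a spanning tree exactly when that edge is internally semi-passive. -/
theorem exists_generic_weight [Fintype E] (G : MultiDigraph V E) (o : LinearOrder E) :
    ∃ w : E → ℝ, (∀ f, 0 < w f) ∧ ∀ T, G.IsSpanningTree T → ∀ e ∈ T,
      (G.InternallySemiPassive o T e → G.treeCoord T e (∑ f, w f • G.edgeVector f) < 0) ∧
      (¬ G.InternallySemiPassive o T e → 0 < G.treeCoord T e (∑ f, w f • G.edgeVector f)) := by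
  obtain ⟨w, hw, hs⟩ := exists_dominating_weight E o
  refine ⟨w, hw, fun T hT e he => ?_⟩
  have hz : ∀ f, (∀ g ∈ G.fundamentalCut T e, o.le g f) → ∀ g, o.lt f g →
      G.treeCoord T e (G.edgeVector g) = 0 := fun f hmax g hg =>
    treeCoord_edgeVector_of_notMem_cut fun h => not_le_of_gt hg (hmax g h)
  simp only [map_sum, map_smul, smul_eq_mul]
  constructor
  · rintro ⟨-, f, hf, hmax, hpar⟩
    have := hs (fun g => -G.treeCoord T e (G.edgeVector g))
      (fun g => by simpa using abs_treeCoord_edgeVector_le G T e g) f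
      (by rw [hT.treeCoord_edgeVector_of_not_standsParallel hf hpar, neg_neg])
      (fun g hg => by simp [hz f hmax g hg])
    simpa using this
  · intro hp
    obtain ⟨f, hf, hmax⟩ := Set.exists_max_image (G.fundamentalCut T e) id (Set.toFinite _)
      ⟨e, hT.mem_fundamentalCut he⟩
    have hpar : G.StandsParallel T e f := by
      by_contra h
      exact hp ⟨he, f, hf, hmax, h⟩
    exact hs _ (fun g => abs_treeCoord_edgeVector_le G T e g) f
      (treeCoord_edgeVector_of_standsParallel hf hpar) (hz f hmax)

end Generic


/-! ### Half-open decomposition and lattice point count. -/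

section Count

variable {V E : Type*} [Fintype V] [DecidableEq V] {G : MultiDigraph V E} {T T' : Set E}
  {o : LinearOrder E} {y : V → ℝ} {𝒯 : Set (Set E)} {X : Set (V → ℝ)} {k : ℕ}

/-- The simplicial cone of a spanning tree `T`, without the facets opposite to the internally
semi-passive edges. -/
def halfOpenCone (G : MultiDigraph V E) (o : LinearOrder E) (T : Set E) : Set (V → ℝ) :=
  {y | ∑ v, y v = 0 ∧ ∀ e ∈ T, 0 ≤ G.treeCoord T e y ∧
    (G.InternallySemiPassive o T e → 0 < G.treeCoord T e y)}

/-- The integer points of the `k`-th dilate of `X`. -/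
def latticePoints (X : Set (V → ℝ)) (k : ℕ) : Set (V → ℝ) :=
  {y | (∀ v, ∃ n : ℤ, y v = n) ∧ ∃ x ∈ X, y = (k : ℝ) • x}

variable [Fintype E]

omit [DecidableEq V] in
/-- Moving a point of the half-open cone of `T` slightly in a generic direction leads into the
interior of the cone. -/
theorem eventually_of_mem_halfOpenCone {q : V → ℝ}
    (hq : ∀ e ∈ T, ¬ G.InternallySemiPassive o T e → 0 < G.treeCoord T e q)
    (hy : y ∈ G.halfOpenCone o T) :
    ∀ᶠ δ : ℝ in nhdsWithin 0 (Set.Ioi 0), ∀ e ∈ T, 0 < G.treeCoord T e (y + δ • q) := by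
  rw [Filter.eventually_all_finite (Set.toFinite T)]
  intro e he
  simp only [map_add, map_smul, smul_eq_mul]
  by_cases hp : G.InternallySemiPassive o T e
  · have h0 := (hy.2 e he).2 hp
    have : ContinuousAt (fun δ : ℝ => G.treeCoord T e y + δ * G.treeCoord T e q) 0 := by fun_prop
    refine nhdsWithin_le_nhds (this.eventually (lt_mem_nhds ?_))
    simpa using h0
  · filter_upwards [self_mem_nhdsWithin] with δ hδ
    exact add_pos_of_nonneg_of_pos (hy.2 e he).1 (mul_pos hδ (hq e he hp))

omit [DecidableEq V] [Fintype E] in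
-- Either some coefficient is already negative and stays so, or a semi-passive one vanishes and `q`
-- makes it negative.
theorem eventually_of_notMem_halfOpenCone {q : V → ℝ}
    (hq : ∀ e ∈ T, G.InternallySemiPassive o T e → G.treeCoord T e q < 0)
    (hy0 : ∑ v, y v = 0) (hy : y ∉ G.halfOpenCone o T) :
    ∀ᶠ δ : ℝ in nhdsWithin 0 (Set.Ioi 0), ¬ ∀ e ∈ T, 0 ≤ G.treeCoord T e (y + δ • q) := by
  have : ∃ e ∈ T, G.treeCoord T e y < 0 ∨
      G.treeCoord T e y ≤ 0 ∧ G.InternallySemiPassive o T e := by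
    by_contra! h
    exact hy ⟨hy0, fun e he => ⟨(h e he).1, fun hp => not_le.1 fun h' => (h e he).2 h' hp⟩⟩
  obtain ⟨e, he, h⟩ := this
  suffices ∀ᶠ δ : ℝ in nhdsWithin 0 (Set.Ioi 0), G.treeCoord T e (y + δ • q) < 0 by
    filter_upwards [this] with δ hδ h
    exact absurd (h e he) (not_le.2 hδ)
  simp only [map_add, map_smul, smul_eq_mul]
  rcases h with h | ⟨h, hp⟩
  · have : ContinuousAt (fun δ : ℝ => G.treeCoord T e y + δ * G.treeCoord T e q) 0 := by fun_prop
    refine nhdsWithin_le_nhds (this.eventually (gt_mem_nhds ?_))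
    simpa using h
  · filter_upwards [self_mem_nhdsWithin] with δ hδ
    exact add_neg_of_nonpos_of_neg h (mul_neg_of_pos_of_neg hδ (hq e he hp))

theorem Dissects.exists_combination (hD : G.Dissects 𝒯 X) {x : V → ℝ} (hx : x ∈ X) :
    ∃ T ∈ 𝒯, (∀ e ∈ T, 0 ≤ G.treeCoord T e x) ∧
      ∃ a : E → ℝ, (∀ e, 0 ≤ a e) ∧ ∑ e, a e • G.edgeVector e = x := by
  classical
  rw [← hD.2.2, Set.mem_iUnion₂] at hx
  obtain ⟨T, hT, hx⟩ := hx
  obtain ⟨a, ha, -, rfl⟩ := (mem_convexHull_image_iff _ _).1 hx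
  refine ⟨T, hT, fun e he => ?_, fun e => ∑ f : T, if (f : E) = e then a f else 0,
    fun e => Finset.sum_nonneg fun f _ => ?_, ?_⟩
  · exact ((hD.1 T hT).treeCoord_sum a ⟨e, he⟩).symm ▸ ha _
  · split_ifs
    exacts [ha _, le_rfl]
  · simp only [Finset.sum_smul]
    rw [Finset.sum_comm]
    simp [ite_smul]

/-- For small `δ > 0`, a `y` outside all half-open cones would move to a point `y + δ q` outside all
closed cones. But this point is a nonnegative combination of edge vectors, hence a multiple of a
point of some `Q_T`. -/
theorem Dissects.exists_mem_halfOpenCone (hD : G.Dissects 𝒯 X)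
    (hcone : ∀ a : E → ℝ, (∀ f, 0 ≤ a f) → ∃ s : ℝ, 0 ≤ s ∧ ∃ x ∈ X,
      ∑ f, a f • G.edgeVector f = s • x)
    (o : LinearOrder E) (hy : ∃ x ∈ X, y = (k : ℝ) • x) :
    ∃ T ∈ 𝒯, y ∈ G.halfOpenCone o T := by
  obtain ⟨x, hx, rfl⟩ := hy
  obtain ⟨-, -, -, a, ha, rfl⟩ := hD.exists_combination hx
  obtain ⟨w, hw, hq⟩ := exists_generic_weight G o
  by_contra! h
  have hev : ∀ᶠ δ : ℝ in nhdsWithin 0 (Set.Ioi 0), ∀ T ∈ 𝒯, ¬ ∀ e ∈ T,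
      0 ≤ G.treeCoord T e ((k : ℝ) • ∑ f, a f • G.edgeVector f +
        δ • ∑ f, w f • G.edgeVector f) := by
    rw [Filter.eventually_all_finite (Set.toFinite 𝒯)]
    intro T hT
    refine eventually_of_notMem_halfOpenCone (fun e he => (hq T (hD.1 T hT) e he).1) ?_ (h T hT)
    have := sum_linearCombination (G := G) (fun f => k * a f) fun f => f
    simpa only [mul_smul, ← Finset.smul_sum] using this
  obtain ⟨δ, hδ, hδ0⟩ := (hev.and self_mem_nhdsWithin).exists
  obtain ⟨s, hs, x, hx, hsx⟩ := hcone (fun f => k * a f + δ * w f) fun f =>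
    add_nonneg (mul_nonneg k.cast_nonneg (ha f)) (mul_nonneg (le_of_lt hδ0) (hw f).le)
  obtain ⟨T, hT, hxT, -⟩ := hD.exists_combination hx
  refine hδ T hT fun e he => ?_
  simp only [add_smul, mul_smul, Finset.sum_add_distrib, ← Finset.smul_sum] at hsx
  rw [hsx, map_smul]
  exact mul_nonneg hs (hxT e he)

/-- A common point, moved slightly along `q`, lies in both open cones. Scaled into either simplex,
it is the same point of `X` by `hray`, which contradicts the disjointness of the relative interiors
unless the trees agree. -/
theorem Dissects.eq_of_mem_halfOpenCone [Nontrivial V] (hD : G.Dissects 𝒯 X)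
    (hray : ∀ x ∈ X, ∀ x' ∈ X, ∀ s s' : ℝ, 0 ≤ s → 0 ≤ s' → s • x = s' • x' → s = s')
    (hT : T ∈ 𝒯) (hT' : T' ∈ 𝒯) (hy : y ∈ G.halfOpenCone o T) (hy' : y ∈ G.halfOpenCone o T') :
    T = T' := by
  classical
  obtain ⟨w, hw, hq⟩ := exists_generic_weight G o
  obtain ⟨δ, h, h'⟩ := ((eventually_of_mem_halfOpenCone
      (fun e he => (hq T (hD.1 T hT) e he).2) hy).and
    (eventually_of_mem_halfOpenCone
      (fun e he => (hq T' (hD.1 T' hT') e he).2) hy')).exists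
  set z := y + δ • ∑ f, w f • G.edgeVector f
  have hz : ∑ v, z v = 0 := by
    have := sum_linearCombination (G := G) w fun f => f
    simp only [z, Pi.add_apply, Pi.smul_apply, smul_eq_mul, Finset.sum_add_distrib,
      ← Finset.mul_sum, hy.1, this, mul_zero, add_zero]
  have key : ∀ T ∈ 𝒯, (∀ e ∈ T, 0 < G.treeCoord T e z) → ∃ s : ℝ, 0 < s ∧
      s⁻¹ • z ∈ intrinsicInterior ℝ (G.rootPolytopeOf T) ∧ s⁻¹ • z ∈ X := by
    intro T hT h
    have hne := (hD.1 T hT).nonempty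
    have : Nonempty T := hne.to_subtype
    have hs : 0 < ∑ e : T, G.treeCoord T e z :=
      Finset.sum_pos (fun e _ => h e e.2) Finset.univ_nonempty
    have hmem : (∑ e : T, G.treeCoord T e z)⁻¹ • z ∈
        intrinsicInterior ℝ (G.rootPolytopeOf T) := by
      refine (hD.1 T hT).mem_intrinsicInterior hne ?_ (fun e => ?_) ?_
      · simp [← Finset.mul_sum, hz]
      · rw [map_smul]
        exact mul_pos (inv_pos.2 hs) (h e e.2)
      · simp only [map_smul, smul_eq_mul, ← Finset.mul_sum]
        exact inv_mul_cancel₀ hs.ne'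
    refine ⟨_, hs, hmem, ?_⟩
    rw [← hD.2.2]
    exact Set.mem_biUnion hT (intrinsicInterior_subset hmem)
  obtain ⟨s, hs, hsI, hsX⟩ := key T hT h
  obtain ⟨s', hs', hsI', hsX'⟩ := key T' hT' h'
  have hss : s = s' := hray _ hsX _ hsX' s s' hs.le hs'.le (by
    rw [smul_inv_smul₀ hs.ne', smul_inv_smul₀ hs'.ne'])
  subst hss
  by_contra hne
  exact Set.disjoint_left.1 (hD.2.1 T hT T' hT' hne) hsI hsI'

/-- The number of lattice points in the `k`-th dilate of a unimodular simplex with `d` vertices and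
with `p` facets removed. -/
noncomputable def compositionCount (d p k : ℕ) : ℕ :=
  {μ : Fin d → ℕ | ∑ i, μ i + p = k}.ncard

theorem finite_compositions (d p k : ℕ) : {μ : Fin d → ℕ | ∑ i, μ i + p = k}.Finite := by
  refine (Set.finite_Iic fun _ => k).subset fun μ hμ i => ?_
  have : μ i ≤ ∑ i, μ i := Finset.single_le_sum (fun _ _ => Nat.zero_le _) (Finset.mem_univ i)
  have h : ∑ i, μ i + p = k := hμ
  lia

theorem compositionCount_self (d k : ℕ) : compositionCount d k k = 1 := by
  have : {μ : Fin d → ℕ | ∑ i, μ i + k = k} = {0} := by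
    ext μ
    simp [funext_iff]
  rw [compositionCount, this, Set.ncard_singleton]

theorem compositionCount_of_lt (d : ℕ) {p k : ℕ} (h : k < p) : compositionCount d p k = 0 := by
  have : {μ : Fin d → ℕ | ∑ i, μ i + p = k} = ∅ := by
    ext μ
    simp
    lia
  rw [compositionCount, this, Set.ncard_empty]

theorem Dissects.exists_parametrization [Nontrivial V] (hD : G.Dissects 𝒯 X)
    (hray : ∀ x ∈ X, ∀ x' ∈ X, ∀ s s' : ℝ, 0 ≤ s → 0 ≤ s' → s • x = s' • x' → s = s')
    (hT : T ∈ 𝒯) (o : LinearOrder E) (k : ℕ) :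
    ∃ F : (Fin (Nat.card T) → ℕ) → V → ℝ, Function.Injective F ∧
      latticePoints X k ∩ G.halfOpenCone o T =
        F '' {μ | ∑ i, μ i + G.internalSemiPassivity o T = k} := by
  classical
  have hTr := hD.1 T hT
  obtain ⟨ψ⟩ : Nonempty (T ≃ Fin (Nat.card T)) := ⟨Finite.equivFin T⟩
  let p : T → ℕ := fun e => if G.InternallySemiPassive o T e then 1 else 0
  have hp : ∑ e, p e = G.internalSemiPassivity o T := by
    have : {e | G.InternallySemiPassive o T e} =
        Subtype.val '' {e : T | G.InternallySemiPassive o T e} := by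
      ext e
      simp only [Set.mem_ofPred_eq, Set.mem_image, Subtype.exists, exists_and_left,
        exists_prop, exists_eq_right_right]
      exact ⟨fun h => ⟨h, h.1⟩, fun h => h.1⟩
    rw [internalSemiPassivity, this, Set.ncard_image_of_injective _ Subtype.val_injective,
      Set.ncard_eq_toFinset_card']
    simp [p]
  -- An integer coefficient that must be positive is at least 1; the shift by `p` absorbs this.
  let F : (Fin (Nat.card T) → ℕ) → V → ℝ := fun μ =>
    ∑ e : T, ((μ (ψ e) + p e : ℕ) : ℝ) • G.edgeVector e
  have hF : ∀ μ (e : T), G.treeCoord T e (F μ) = ((μ (ψ e) + p e : ℕ) : ℝ) := fun μ e =>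
    hTr.treeCoord_sum _ e
  have hF0 : ∀ μ, ∑ v, F μ v = 0 := fun μ => sum_linearCombination _ _
  refine ⟨F, ?_, ?_⟩
  · intro μ ν h
    ext i
    have h1 := hF μ (ψ.symm i)
    rw [h, hF, Nat.cast_inj, ψ.apply_symm_apply] at h1
    exact (Nat.add_right_cancel h1).symm
  -- By `hray`, the dilation factor of `y` relative to `X` is its coefficient sum over `T`.
  · have hsum : ∀ y ∈ G.halfOpenCone o T, (∃ x ∈ X, y = (k : ℝ) • x) ↔
        ∑ e : T, G.treeCoord T e y = k := by
      intro y hy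
      obtain ⟨x, hx, hyx⟩ := hTr.exists_eq_smul hTr.nonempty hy.1 fun e => (hy.2 e e.2).1
      have hxX : x ∈ X := hD.2.2 ▸ Set.mem_biUnion hT hx
      constructor
      · rintro ⟨x', hx', hyx'⟩
        exact hray x hxX x' hx' _ _ (Finset.sum_nonneg fun e _ => (hy.2 e e.2).1)
          k.cast_nonneg (hyx.symm.trans hyx')
      · intro h
        exact ⟨x, hxX, by rw [← h]; exact hyx⟩
    ext y
    constructor
    · rintro ⟨⟨hint, hk⟩, hy⟩
      rw [hsum y hy] at hk
      have hc : ∀ e : T, ∃ n : ℕ, G.treeCoord T e y = ((n + p e : ℕ) : ℝ) := by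
        intro e
        obtain ⟨n, hn⟩ := exists_int_treeCoord_eq G T e hint
        have hpn : (p e : ℤ) ≤ n := by
          by_cases h : G.InternallySemiPassive o T e
          · have := (hy.2 e e.2).2 h
            rw [hn] at this
            simp only [p, h, if_true]
            exact_mod_cast this
          · have := (hy.2 e e.2).1
            rw [hn] at this
            simp only [p, h, if_false]
            exact_mod_cast this
        refine ⟨(n - p e).toNat, ?_⟩
        rw [hn]
        have : ((n - p e).toNat + p e : ℤ) = n := by lia
        exact_mod_cast this.symm
      choose n hn using hc
      have hFy : F (n ∘ ψ.symm) = y := by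
        rw [← hTr.sum_treeCoord_smul hy.1]
        simp only [F, hn, Function.comp_apply, ψ.symm_apply_apply]
      refine ⟨n ∘ ψ.symm, ?_, hFy⟩
      simp only [hn] at hk
      rw [Set.mem_ofPred_eq, ← hp, ← Equiv.sum_comp ψ, ← Finset.sum_add_distrib]
      simp only [Function.comp_apply, Equiv.symm_apply_apply]
      exact_mod_cast hk
    · rintro ⟨μ, hμ, rfl⟩
      have hy : F μ ∈ G.halfOpenCone o T := by
        refine ⟨hF0 μ, fun e he => ?_⟩
        rw [hF μ ⟨e, he⟩]
        refine ⟨Nat.cast_nonneg _, fun h => ?_⟩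
        simp only [p, h, if_true]
        positivity
      refine ⟨⟨fun v => ?_, (hsum _ hy).2 ?_⟩, hy⟩
      · refine ⟨∑ e : T, (μ (ψ e) + p e : ℕ) * ((if v = G.head e then 1 else 0) -
          (if v = G.tail e then 1 else 0)), ?_⟩
        simp [F, Finset.sum_apply, edgeVector, Pi.single_apply]
      · simp only [hF]
        rw [Set.mem_ofPred_eq, ← hp, ← Equiv.sum_comp ψ, ← Finset.sum_add_distrib] at hμ
        exact_mod_cast hμ

theorem Dissects.ncard_latticePoints [Nontrivial V] (hD : G.Dissects 𝒯 X)
    (hray : ∀ x ∈ X, ∀ x' ∈ X, ∀ s s' : ℝ, 0 ≤ s → 0 ≤ s' → s • x = s' • x' → s = s')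
    (hcone : ∀ a : E → ℝ, (∀ f, 0 ≤ a f) → ∃ s : ℝ, 0 ≤ s ∧ ∃ x ∈ X,
      ∑ f, a f • G.edgeVector f = s • x)
    (o : LinearOrder E) (k : ℕ) :
    (latticePoints X k).ncard = ∑ T ∈ (Set.toFinite 𝒯).toFinset, compositionCount
      (Module.finrank ℝ (LinearMap.ker (∑ v, LinearMap.proj v : (V → ℝ) →ₗ[ℝ] ℝ)))
      (G.internalSemiPassivity o T) k := by
  classical
  have hcard : ∀ T ∈ 𝒯, (latticePoints X k ∩ G.halfOpenCone o T).Finite ∧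
      (latticePoints X k ∩ G.halfOpenCone o T).ncard = compositionCount
      (Module.finrank ℝ (LinearMap.ker (∑ v, LinearMap.proj v : (V → ℝ) →ₗ[ℝ] ℝ)))
      (G.internalSemiPassivity o T) k := by
    intro T hT
    obtain ⟨F, hF, h⟩ := hD.exists_parametrization hray hT o k
    rw [h, Set.ncard_image_of_injective _ hF, ← (hD.1 T hT).card_eq, ← Nat.card_eq_fintype_card]
    exact ⟨(finite_compositions _ _ _).image F, rfl⟩
  have hU : latticePoints X k =
      ⋃ T ∈ 𝒯, latticePoints X k ∩ G.halfOpenCone o T := by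
    ext y
    simp only [Set.mem_iUnion, Set.mem_inter_iff, exists_prop]
    constructor
    · intro hy
      obtain ⟨T, hT, hyT⟩ := hD.exists_mem_halfOpenCone hcone o hy.2
      exact ⟨T, hT, hy, hyT⟩
    · rintro ⟨T, -, hy, -⟩
      exact hy
  have hdis : ∀ T ∈ 𝒯, ∀ T' ∈ 𝒯, T ≠ T' →
      Disjoint (latticePoints X k ∩ G.halfOpenCone o T)
        (latticePoints X k ∩ G.halfOpenCone o T') := fun T hT T' hT' hne =>
    Set.disjoint_left.2 fun y hy hy' => hne (hD.eq_of_mem_halfOpenCone hray hT hT' hy.2 hy'.2)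
  rw [hU, Set.Finite.ncard_biUnion (Set.toFinite 𝒯) (fun T hT => (hcard T hT).1) hdis,
    finsum_mem_eq_finite_toFinset_sum _ (Set.toFinite 𝒯)]
  exact Finset.sum_congr rfl fun T hT => (hcard T (by simpa using hT)).2

end Count

/-! ### Recovering multiplicities from a triangular system. -/

theorem sum_triangular_eq {γ : Type*} (C : Finset γ) (s : γ → ℕ) (g : ℕ → ℕ → ℕ)
    (hg : ∀ k, g k k = 1) (hg' : ∀ j k, k < j → g j k = 0) (i : ℕ) :
    ∑ c ∈ C, g (s c) i = ∑ j ∈ Finset.range i, (C.filter fun c => s c = j).card * g j i +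
      (C.filter fun c => s c = i).card := by
  have h1 : ∀ c, g (s c) i = ∑ j ∈ Finset.range (i + 1), if s c = j then g j i else 0 := by
    intro c
    rw [Finset.sum_ite_eq]
    split_ifs with hc
    · rfl
    · exact hg' _ _ (by simpa using hc)
  simp only [h1]
  rw [Finset.sum_comm, Finset.sum_range_succ]
  simp [← Finset.sum_filter, hg]

/-- A triangular system of counts determines its multiplicities. -/
theorem card_filter_eq_of_sum_eq {α β : Type*} (A : Finset α) (B : Finset β) (p : α → ℕ)
    (r : β → ℕ) (g : ℕ → ℕ → ℕ) (hg : ∀ k, g k k = 1) (hg' : ∀ j k, k < j → g j k = 0)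
    (h : ∀ k, ∑ a ∈ A, g (p a) k = ∑ b ∈ B, g (r b) k) (i : ℕ) :
    (A.filter fun a => p a = i).card = (B.filter fun b => r b = i).card := by
  induction i using Nat.strong_induction_on with
  | _ i ih =>
    have hi := h i
    rw [sum_triangular_eq A p g hg hg', sum_triangular_eq B r g hg hg',
      Finset.sum_congr rfl fun j hj => by rw [ih j (Finset.mem_range.1 hj)]] at hi
    exact Nat.add_left_cancel hi

/-! ### Independence of the tree set and the ordering. -/

section Invariance

variable {V E : Type*} [Fintype V] [DecidableEq V] [Nontrivial V] [Fintype E]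
  {G : MultiDigraph V E} {X : Set (V → ℝ)} {𝒯₁ 𝒯₂ : Set (Set E)}

theorem Dissects.ncard_internalSemiPassivity_eq (h₁ : G.Dissects 𝒯₁ X) (h₂ : G.Dissects 𝒯₂ X)
    (hray : ∀ x ∈ X, ∀ x' ∈ X, ∀ s s' : ℝ, 0 ≤ s → 0 ≤ s' → s • x = s' • x' → s = s')
    (hcone : ∀ a : E → ℝ, (∀ f, 0 ≤ a f) → ∃ s : ℝ, 0 ≤ s ∧ ∃ x ∈ X,
      ∑ f, a f • G.edgeVector f = s • x)
    (o₁ o₂ : LinearOrder E) (i : ℕ) :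
    {T ∈ 𝒯₁ | G.internalSemiPassivity o₁ T = i}.ncard =
      {T ∈ 𝒯₂ | G.internalSemiPassivity o₂ T = i}.ncard := by
  classical
  have key := card_filter_eq_of_sum_eq (Set.toFinite 𝒯₁).toFinset (Set.toFinite 𝒯₂).toFinset
    (G.internalSemiPassivity o₁) (G.internalSemiPassivity o₂) _ (compositionCount_self _)
    (fun j k => compositionCount_of_lt _)
    (fun k => (h₁.ncard_latticePoints hray hcone o₁ k).symm.trans
      (h₂.ncard_latticePoints hray hcone o₂ k)) i
  have conv : ∀ (𝒯 : Set (Set E)) (o : LinearOrder E),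
      {T ∈ 𝒯 | G.internalSemiPassivity o T = i}.ncard =
        ((Set.toFinite 𝒯).toFinset.filter fun T => G.internalSemiPassivity o T = i).card := by
    intro 𝒯 o
    rw [← Set.ncard_coe_finset]
    congr 1
    ext T
    simp
  rw [conv, conv, key]

end Invariance


/-- An empty tree set forces `X` to be empty, while every tree has an edge and so contributes a
point. This settles the case in which no spanning tree is at hand. -/
theorem Dissects.eq_empty_of_eq_empty {V E : Type*} [DecidableEq V] [Nontrivial V]
    {G : MultiDigraph V E} {𝒯₁ 𝒯₂ : Set (Set E)} {X : Set (V → ℝ)} (h₁ : G.Dissects 𝒯₁ X)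
    (h₂ : G.Dissects 𝒯₂ X) (h : 𝒯₁ = ∅) : 𝒯₂ = ∅ := by
  subst h
  by_contra hne
  obtain ⟨T, hT⟩ := Set.nonempty_iff_ne_empty.2 hne
  obtain ⟨e, he⟩ := (h₂.1 T hT).nonempty
  have h : G.edgeVector e ∈ X :=
    h₂.2.2 ▸ Set.mem_biUnion hT (subset_convexHull _ _ ⟨e, he, rfl⟩)
  simp [← h₁.2.2] at h

/-! ### Semi-balanced digraphs. -/

section SemiBalanced

variable {V E : Type*} [DecidableEq V] {G : MultiDigraph V E} {T : Set E}

theorem Cycle.sum_edgeVector (C : G.Cycle) :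
    ∑ i, (if C.fwd i = true then (1 : ℝ) else -1) • G.edgeVector (C.edge i) = 0 := by
  have h : ∀ i, (if C.fwd i = true then (1 : ℝ) else -1) • G.edgeVector (C.edge i) =
      Pi.single (C.vert (i + 1)) 1 - Pi.single (C.vert i) 1 := by
    intro i
    have := C.joins i
    split_ifs at this ⊢ <;> simp [edgeVector, this.1, this.2]
  simp only [h, Finset.sum_sub_distrib]
  rw [sub_eq_zero]
  exact Equiv.sum_comp (Equiv.addRight 1) fun i => (Pi.single (C.vert i) 1 : V → ℝ)

omit [DecidableEq V] in
theorem SemiBalanced.sum_fwd (hG : G.SemiBalanced) (C : G.Cycle) :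
    ∑ i, (if C.fwd i = true then (1 : ℝ) else -1) = 0 := by
  have h := hG C
  have h1 : ∀ b, {i | C.fwd i = b}.ncard = (Finset.univ.filter fun i => C.fwd i = b).card := by
    intro b
    rw [← Set.ncard_coe_finset]
    simp
  rw [h1, h1] at h
  rw [Finset.sum_ite]
  simp [h]

/-- A linear functional that is one on the edges of a spanning tree of a semi-balanced digraph is
one on all the edges. -/
theorem SemiBalanced.apply_edgeVector (hG : G.SemiBalanced) (hT : G.IsSpanningTree T)
    (φ : (V → ℝ) →ₗ[ℝ] ℝ) (hφ : ∀ e ∈ T, φ (G.edgeVector e) = 1) (f : E) :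
    φ (G.edgeVector f) = 1 := by
  by_cases hf : f ∈ T
  · exact hφ f hf
  obtain ⟨C, i, rfl, hC⟩ := exists_cycle_of_sameComponent hf (hT.1 _ _)
  -- Around the cycle both the signed edge vectors and the signs sum to zero; on edges of `T` the
  -- second factor vanishes, so only the term of `f` remains.
  have h1 : ∑ j, (if C.fwd j = true then (1 : ℝ) else -1) *
      (φ (G.edgeVector (C.edge j)) - 1) = 0 := by
    have h := congrArg φ C.sum_edgeVector
    simp only [map_sum, map_smul, smul_eq_mul, map_zero] at h
    simp only [mul_sub, mul_one, Finset.sum_sub_distrib, h, hG.sum_fwd C, sub_self]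
  rw [Finset.sum_eq_single i] at h1
  · rcases mul_eq_zero.1 h1 with h | h
    · split_ifs at h <;> simp at h
    · exact sub_eq_zero.1 h
  · intro j _ hj
    rw [hφ _ (hC j hj), sub_self, mul_zero]
  · simp

theorem exists_eq_smul_mem_rootPolytope [Fintype E] [Nonempty E] (G : MultiDigraph V E)
    {a : E → ℝ} (ha : ∀ f, 0 ≤ a f) :
    ∃ s : ℝ, 0 ≤ s ∧ ∃ x ∈ G.rootPolytope, ∑ f, a f • G.edgeVector f = s • x := by
  have hs := Finset.sum_nonneg fun f (_ : f ∈ Finset.univ) => ha f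
  refine ⟨∑ f, a f, hs, ?_⟩
  rcases eq_or_lt_of_le hs with h0 | h0
  · obtain ⟨f⟩ := ‹Nonempty E›
    refine ⟨G.edgeVector f, subset_convexHull _ _ ⟨f, trivial, rfl⟩, ?_⟩
    rw [← h0, zero_smul]
    refine Finset.sum_eq_zero fun f _ => ?_
    rw [(Finset.sum_eq_zero_iff_of_nonneg fun e _ => ha e).1 h0.symm f (Finset.mem_univ _),
      zero_smul]
  · refine ⟨(∑ f, a f)⁻¹ • ∑ f, a f • G.edgeVector f, ?_, (smul_inv_smul₀ h0.ne' _).symm⟩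
    refine mem_convexHull_of_exists_fintype (fun f => (∑ f, a f)⁻¹ * a f) G.edgeVector
      (fun f => mul_nonneg (inv_nonneg.2 hs) (ha f)) ?_ (fun f => ⟨f, trivial, rfl⟩) ?_
    · rw [← Finset.mul_sum, inv_mul_cancel₀ h0.ne']
    · simp only [mul_smul, ← Finset.smul_sum]

variable [Fintype V]

/-- The sum of the coefficients over `T` is 1 on every edge vector, hence on all of `Q_G`. -/
theorem SemiBalanced.eq_of_smul_eq_smul [Finite E] (hG : G.SemiBalanced)
    (hT : G.IsSpanningTree T) {x x' : V → ℝ} (hx : x ∈ G.rootPolytope) (hx' : x' ∈ G.rootPolytope)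
    {s s' : ℝ} (h : s • x = s' • x') : s = s' := by
  classical
  have := Fintype.ofFinite E
  let φ : (V → ℝ) →ₗ[ℝ] ℝ := ∑ e : T, G.treeCoord T e
  have hφ : ∀ e ∈ T, φ (G.edgeVector e) = 1 := by
    intro e he
    rw [LinearMap.sum_apply, Finset.sum_eq_single ⟨e, he⟩]
    · exact hT.treeCoord_self he
    · intro f _ hf
      exact treeCoord_of_ne he fun h => hf (Subtype.ext h.symm)
    · simp
  have key : ∀ z ∈ G.rootPolytope, φ z = 1 := fun z hz =>
    apply_eq_of_mem_affineSpan φ (s := G.edgeVector '' Set.univ)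
      (by rintro _ ⟨f, -, rfl⟩; exact hG.apply_edgeVector hT φ hφ f)
      (convexHull_subset_affineSpan _ hz)
  have := congrArg φ h
  simpa [key x hx, key x' hx'] using this

end SemiBalanced

end MultiDigraph

/-! ### The symmetric edge polytope and its boundary. -/

namespace SimpleGraph

open MultiDigraph Pointwise

variable {V : Type*} [DecidableEq V] {𝒢 : SimpleGraph V} {T : Set 𝒢.Dart} {x : V → ℝ}

theorem rootPolytope_bidirected (𝒢 : SimpleGraph V) :
    𝒢.bidirected.rootPolytope = 𝒢.symmetricEdgePolytope := by
  rw [rootPolytope, rootPolytopeOf, symmetricEdgePolytope]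
  congr 1
  ext x
  constructor
  · rintro ⟨d, -, rfl⟩
    exact ⟨d.fst, d.snd, d.adj, Or.inr rfl⟩
  · rintro ⟨u, v, huv, rfl | rfl⟩
    · exact ⟨⟨(v, u), huv.symm⟩, trivial, rfl⟩
    · exact ⟨⟨(u, v), huv⟩, trivial, rfl⟩

theorem neg_edgeVector_mem (d : 𝒢.Dart) :
    -𝒢.bidirected.edgeVector d ∈ 𝒢.bidirected.rootPolytope := by
  refine subset_convexHull _ _ ⟨d.symm, trivial, ?_⟩
  simp [edgeVector, bidirected]

theorem smul_edgeVector_mem (d : 𝒢.Dart) (c : ℝ) :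
    c • 𝒢.bidirected.edgeVector d ∈ |c| • 𝒢.bidirected.rootPolytope := by
  rcases le_total 0 c with h | h
  · rw [abs_of_nonneg h]
    exact Set.smul_mem_smul_set (subset_convexHull _ _ ⟨d, trivial, rfl⟩)
  · rw [abs_of_nonpos h, ← neg_smul_neg]
    exact Set.smul_mem_smul_set (neg_edgeVector_mem d)

theorem zero_mem_rootPolytope [Nonempty 𝒢.Dart] : 0 ∈ 𝒢.bidirected.rootPolytope := by
  obtain ⟨d⟩ := ‹Nonempty 𝒢.Dart›
  have h := convex_convexHull ℝ (𝒢.bidirected.edgeVector '' Set.univ)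
    (subset_convexHull _ _ ⟨d, trivial, rfl⟩) (neg_edgeVector_mem d)
    (a := 1 / 2) (b := 1 / 2) (by norm_num) (by norm_num) (by norm_num)
  rwa [← smul_add, add_neg_cancel, smul_zero] at h

variable [Fintype V]

/-- Shrinking `x` leaves room `1 - s`. As the polytope contains both signs of each edge vector, it
absorbs every perturbation whose coefficients over `T` have absolute values summing to less than
that. -/
theorem smul_mem_intrinsicInterior [Nonempty 𝒢.Dart] (hT : 𝒢.bidirected.IsSpanningTree T)
    (hx : x ∈ 𝒢.bidirected.rootPolytope) {s : ℝ} (hs0 : 0 ≤ s) (hs1 : s < 1) :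
    s • x ∈ intrinsicInterior ℝ 𝒢.bidirected.rootPolytope := by
  classical
  have hconv : Convex ℝ 𝒢.bidirected.rootPolytope := convex_convexHull _ _
  have hzero : ∀ z ∈ affineSpan ℝ 𝒢.bidirected.rootPolytope, ∑ v, z v = 0 := by
    intro z hz
    rw [rootPolytope, rootPolytopeOf, affineSpan_convexHull] at hz
    have := apply_eq_of_mem_affineSpan (∑ v, LinearMap.proj v : (V → ℝ) →ₗ[ℝ] ℝ) (r := 0) ?_ hz
    · simpa [LinearMap.sum_apply] using this
    · rintro _ ⟨e, -, rfl⟩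
      simpa [LinearMap.sum_apply] using sum_edgeVector 𝒢.bidirected e
  have hsx : s • x ∈ 𝒢.bidirected.rootPolytope :=
    hconv.smul_mem_of_zero_mem zero_mem_rootPolytope hx ⟨hs0, hs1.le⟩
  refine mem_intrinsicInterior_of_isOpen
    (U := {z | ∑ e : T, |𝒢.bidirected.treeCoord T e (z - s • x)| < 1 - s})
    (isOpen_lt ?_ continuous_const) hsx (by simpa using hs1) ?_
  · refine continuous_finsetSum _ fun e _ => ?_
    have := LinearMap.continuous_of_finiteDimensional (𝒢.bidirected.treeCoord T e)
    fun_prop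
  · intro z hz hzU
    have hd : ∑ v, (z - s • x) v = 0 := by
      have h1 := hzero z hz
      have h2 := hzero _ (subset_affineSpan ℝ _ hsx)
      simp only [Pi.sub_apply, Finset.sum_sub_distrib, h1, h2, sub_self]
    have key : ∀ F : Finset T, s • x + ∑ e ∈ F, 𝒢.bidirected.treeCoord T e (z - s • x) •
        𝒢.bidirected.edgeVector e ∈ (s + ∑ e ∈ F, |𝒢.bidirected.treeCoord T e (z - s • x)|) •
          𝒢.bidirected.rootPolytope := by
      intro F
      induction F using Finset.induction_on with
      | empty => simpa using Set.smul_mem_smul_set hx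
      | insert e F he ih =>
        rw [Finset.sum_insert he, Finset.sum_insert he, add_left_comm (s • x), add_left_comm s,
          hconv.add_smul (abs_nonneg _) (add_nonneg hs0 (Finset.sum_nonneg fun _ _ => abs_nonneg _))]
        exact Set.add_mem_add (smul_edgeVector_mem _ _) ih
    have h := key Finset.univ
    rw [hT.sum_treeCoord_smul hd, add_sub_cancel] at h
    obtain ⟨p, hp, hpz⟩ := h
    have hzU : ∑ e : T, |𝒢.bidirected.treeCoord T e (z - s • x)| < 1 - s := hzU
    rw [← hpz]
    exact hconv.smul_mem_of_zero_mem zero_mem_rootPolytope hp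
      ⟨add_nonneg hs0 (Finset.sum_nonneg fun _ _ => abs_nonneg _), by linarith⟩

theorem isClosed_rootPolytope (𝒢 : SimpleGraph V) : IsClosed 𝒢.bidirected.rootPolytope := by
  classical
  exact (Set.toFinite _).isClosed_convexHull ℝ

theorem mem_intrinsicFrontier_rootPolytope :
    x ∈ intrinsicFrontier ℝ 𝒢.bidirected.rootPolytope ↔
      x ∈ 𝒢.bidirected.rootPolytope ∧ x ∉ intrinsicInterior ℝ 𝒢.bidirected.rootPolytope := by
  rw [← intrinsicClosure_sdiff_intrinsicInterior,
    ((isClosed_rootPolytope 𝒢).preimage continuous_subtype_val).intrinsicClosure, Set.mem_sdiff]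

/-- If the factors differed, one boundary point would be a proper shrinking of the other and so lie
in the relative interior. -/
theorem eq_of_smul_eq_smul [Nonempty 𝒢.Dart] (hT : 𝒢.bidirected.IsSpanningTree T)
    {x x' : V → ℝ} (hx : x ∈ intrinsicFrontier ℝ 𝒢.bidirected.rootPolytope)
    (hx' : x' ∈ intrinsicFrontier ℝ 𝒢.bidirected.rootPolytope) {s s' : ℝ} (hs : 0 ≤ s)
    (hs' : 0 ≤ s') (h : s • x = s' • x') : s = s' := by
  have key : ∀ x ∈ intrinsicFrontier ℝ 𝒢.bidirected.rootPolytope,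
      ∀ x' ∈ intrinsicFrontier ℝ 𝒢.bidirected.rootPolytope, ∀ s s' : ℝ, 0 ≤ s →
        s • x = s' • x' → s' ≤ s := by
    intro x hx x' hx' s s' hs h
    by_contra! hlt
    have h0 : 0 < s' := hs.trans_lt hlt
    rw [mem_intrinsicFrontier_rootPolytope] at hx hx'
    refine hx'.2 ?_
    have := smul_mem_intrinsicInterior hT hx.1 (div_nonneg hs h0.le) ((div_lt_one h0).2 hlt)
    rwa [div_eq_inv_mul, mul_smul, h, inv_smul_smul₀ h0.ne'] at this
  exact le_antisymm (key _ hx' _ hx _ _ hs' h.symm) (key _ hx _ hx' _ _ hs h)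

/-- Every nonzero ray through a point of the polytope meets its relative boundary. -/
theorem exists_smul_mem_intrinsicFrontier [Nonempty 𝒢.Dart]
    (hx : x ∈ 𝒢.bidirected.rootPolytope) (hx0 : x ≠ 0) :
    ∃ t : ℝ, 0 < t ∧ t • x ∈ intrinsicFrontier ℝ 𝒢.bidirected.rootPolytope := by
  classical
  have hcpt : IsCompact 𝒢.bidirected.rootPolytope := (Set.toFinite _).isCompact_convexHull ℝ
  set A : Set ℝ := {t | t • x ∈ 𝒢.bidirected.rootPolytope} with hA
  have hAcl : IsClosed A := (isClosed_rootPolytope 𝒢).preimage (by fun_prop)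
  have hA1 : (1 : ℝ) ∈ A := by simpa [hA] using hx
  have hAb : BddAbove A := by
    obtain ⟨R, hR⟩ := hcpt.isBounded.exists_norm_le
    refine ⟨R / ‖x‖, fun t ht => ?_⟩
    rw [le_div_iff₀ (norm_pos_iff.2 hx0)]
    refine le_trans ?_ (hR _ ht)
    rw [norm_smul]
    exact mul_le_mul_of_nonneg_right (le_abs_self t) (norm_nonneg x)
  have hmem : sSup A ∈ A := hAcl.csSup_mem ⟨1, hA1⟩ hAb
  have hpos : 0 < sSup A := zero_lt_one.trans_le (le_csSup hAb hA1)
  -- At a relative interior point the ray, which stays in the affine span, could be followed beyond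
  -- the supremum.
  refine ⟨sSup A, hpos, mem_intrinsicFrontier_rootPolytope.2 ⟨hmem, fun hint => ?_⟩⟩
  obtain ⟨p, hp, hpx⟩ := mem_intrinsicInterior.1 hint
  have hspan : ∀ t : ℝ, t • x ∈ affineSpan ℝ 𝒢.bidirected.rootPolytope := by
    intro t
    have := AffineMap.lineMap_mem (k := ℝ) t
      (subset_affineSpan ℝ _ (zero_mem_rootPolytope (𝒢 := 𝒢))) (subset_affineSpan ℝ _ hx)
    simpa [AffineMap.lineMap_apply] using this
  let γ : ℝ → affineSpan ℝ 𝒢.bidirected.rootPolytope := fun t => ⟨t • x, hspan t⟩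
  have hγ : Continuous γ := by
    apply Continuous.subtype_mk
    fun_prop
  have hγp : γ (sSup A) = p := Subtype.ext hpx.symm
  have hev := hγ.continuousAt.eventually_mem (x := sSup A) (hγp ▸ mem_interior_iff_mem_nhds.1 hp)
  obtain ⟨t, ht, hlt⟩ := ((hev.filter_mono nhdsWithin_le_nhds).and
    (self_mem_nhdsWithin (s := Set.Ioi (sSup A)))).exists
  exact absurd (le_csSup hAb ht) (not_le.2 hlt)

end SimpleGraph

/-! ### The two cases of the theorem. -/

theorem mainTheorem6 {V E : Type*} [Fintype V] [DecidableEq V] [Nontrivial V] [Finite E]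
    (i : ℕ) (hi : i < Fintype.card V) :
    (∀ (𝒢 : SimpleGraph V) (𝒯₁ 𝒯₂ : Set (Set 𝒢.Dart)) (o₁ o₂ : LinearOrder 𝒢.Dart),
      𝒢.IsDissectingTreeSet 𝒯₁ → 𝒢.IsDissectingTreeSet 𝒯₂ →
        {T ∈ 𝒯₁ | 𝒢.bidirected.internalSemiPassivity o₁ T = i}.ncard =
          {T ∈ 𝒯₂ | 𝒢.bidirected.internalSemiPassivity o₂ T = i}.ncard) ∧
    (∀ (G : MultiDigraph V E) (𝒯₁ 𝒯₂ : Set (Set E)) (o₁ o₂ : LinearOrder E),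
      G.SemiBalanced → G.IsDissectingTreeSet 𝒯₁ → G.IsDissectingTreeSet 𝒯₂ →
        {T ∈ 𝒯₁ | G.internalSemiPassivity o₁ T = i}.ncard =
          {T ∈ 𝒯₂ | G.internalSemiPassivity o₂ T = i}.ncard) := by
  classical
  constructor
  · intro 𝒢 𝒯₁ 𝒯₂ o₁ o₂ h₁ h₂
    rw [SimpleGraph.IsDissectingTreeSet, ← 𝒢.rootPolytope_bidirected] at h₁ h₂
    rcases 𝒯₁.eq_empty_or_nonempty with he | ⟨T, hT⟩
    · rw [he, h₁.eq_empty_of_eq_empty h₂ he]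
      simp
    have hTr := h₁.1 T hT
    obtain ⟨d, hd⟩ := hTr.nonempty
    have : Nonempty 𝒢.Dart := ⟨d⟩
    have hX : 𝒢.bidirected.edgeVector d ∈ intrinsicFrontier ℝ 𝒢.bidirected.rootPolytope :=
      h₁.2.2 ▸ Set.mem_biUnion hT (subset_convexHull _ _ ⟨d, hd, rfl⟩)
    refine h₁.ncard_internalSemiPassivity_eq h₂ ?_ ?_ o₁ o₂ i
    · exact fun x hx x' hx' s s' hs hs' h => SimpleGraph.eq_of_smul_eq_smul hTr hx hx' hs hs' h
    · intro a ha
      obtain ⟨s, hs, x, hx, hsx⟩ := 𝒢.bidirected.exists_eq_smul_mem_rootPolytope ha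
      rw [hsx]
      -- The origin has no ray of its own, so factor 0 and an arbitrary boundary point serve.
      by_cases hx0 : x = 0
      · exact ⟨0, le_rfl, _, hX, by simp [hx0]⟩
      · obtain ⟨t, ht, htx⟩ := SimpleGraph.exists_smul_mem_intrinsicFrontier hx hx0
        refine ⟨s * t⁻¹, by positivity, t • x, htx, ?_⟩
        rw [mul_smul, inv_smul_smul₀ ht.ne']
  · intro G 𝒯₁ 𝒯₂ o₁ o₂ hG h₁ h₂
    rcases 𝒯₁.eq_empty_or_nonempty with he | ⟨T, hT⟩
    · rw [he, h₁.eq_empty_of_eq_empty h₂ he]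
      simp
    have := Fintype.ofFinite E
    have hTr := h₁.1 T hT
    obtain ⟨e, he⟩ := hTr.nonempty
    have : Nonempty E := ⟨e⟩
    exact MultiDigraph.Dissects.ncard_internalSemiPassivity_eq h₁ h₂
      (fun x hx x' hx' s s' _ _ h => hG.eq_of_smul_eq_smul hTr hx hx' h)
      (fun a ha => G.exists_eq_smul_mem_rootPolytope ha) o₁ o₂ i
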